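/- Let $n,k\ge 0$ be integers. Let $\Delta_n$ be the triangular Ferrers shape, in French notation (left- and bottom-justified), with $n$ cells in the bottom row, $n-1$ cells in the row above, and so on, up to one cell in the topmost row. A $01$-filling of $\Delta_n$ assigns $0$ or $1$ to each cell. An NE-chain of length $l$ in a $01$-filling is a sequence of $l$ cells containing $1$, each strictly above and weakly to the right of the preceding one. The $01$-fillings of $\Delta_n$ such that every row and every column contains at most one $1$ and there is no NE-chain of length $k+1$ are in bijection with the sequences $(\emptyset=\lambda^0,\lambda^1,\dots,\lambda^{2n}=\emptyset)$ of integer partitions (identified with their Ferrers diagrams) such that every $\lambda^i$ has at most $k$ columns and, for $0\le i<n$, $\lambda^{2i+1}$ is obtained from $\lambda^{2i}$ by doing nothing or adding a square, and $\lambda^{2i+2}$ is obtained from $\lambda^{2i+1}$ by doing nothing or deleting a square. More precisely, such a bijection is given by the growth diagram of the filling: label every corner on the left and bottom edges of $\Delta_n$ with the empty partition $\emptyset$. For a cell with entry $m\in\{0,1\}$ whose bottom-left, bottom-right and top-left corners have labels $\rho,\mu,\upsilon$, the top-right corner gets the label $\lambda$ with parts $\lambda_i=\max\{\mu_i+c_i,\upsilon_i\}$,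 where $c_1=m$ and $c_{i+1}=\min\{\mu_i+c_i,\upsilon_i\}-\rho_i$ (partitions are extended by zeros). Then $\lambda^0,\dots,\lambda^{2n}$ are the labels of the corners met when tracing the upper-right border of $\Delta_n$ from its top-left to its bottom-right corner, by steps that alternately go right and down. -/

import Mathlib

/-- The triangular Ferrers shape with `n` cells in the bottom row, `n - 1` cells in the row above,
and so on, up to one cell in the topmost row. Ferrers shapes are in French notation: the cell
`(r, c)` lies in the `r`-th row from the bottom and in the `c`-th column from the left
(both counted from `0`). -/
def triangularShape (n : ℕ) : YoungDiagram where
  cells := (Finset.range n ×ˢ Finset.range n).filter (fun x => x.1 + x.2 < n)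
  isLowerSet := by
    rintro ⟨a, b⟩ ⟨c, d⟩ ⟨h1, h2⟩ h
    simp only [Finset.coe_filter, Finset.mem_product, Finset.mem_range, Set.mem_ofPred_eq] at h ⊢
    simp only at h1 h2
    omega

/-- A `01`-filling of the Ferrers shape `F`. -/
abbrev Filling01 (F : YoungDiagram) : Type := {x : ℕ × ℕ // x ∈ F.cells} → Fin 2

namespace Filling01

/-- The entry in row `r` and column `c` as a natural number (`0` if there is no such cell). -/
def entry {F : YoungDiagram} (f : Filling01 F) (r c : ℕ) : ℕ :=
  if h : (r, c) ∈ F.cells then (f ⟨(r, c), h⟩ : ℕ) else 0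

/-- Every row contains at most one `1`. -/
def RowsAtMostOne {F : YoungDiagram} (f : Filling01 F) : Prop :=
  ∀ x y : {x : ℕ × ℕ // x ∈ F.cells}, f x = 1 → f y = 1 → x.1.1 = y.1.1 → x = y

/-- Every column contains at most one `1`. -/
def ColsAtMostOne {F : YoungDiagram} (f : Filling01 F) : Prop :=
  ∀ x y : {x : ℕ × ℕ // x ∈ F.cells}, f x = 1 → f y = 1 → x.1.2 = y.1.2 → x = y

/-- There is a NE-chain of length `l`: a sequence of `l` ones, each one strictly above and
weakly to the right of the preceding one (the relation is transitive). -/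
def HasNEChain {F : YoungDiagram} (f : Filling01 F) (l : ℕ) : Prop :=
  ∃ x : Fin l → {x : ℕ × ℕ // x ∈ F.cells},
    (∀ s, f (x s) = 1) ∧
    ∀ s t, s < t → (x s).1.1 < (x t).1.1 ∧ (x s).1.2 ≤ (x t).1.2

end Filling01

/-- The successive values of `CARRY` in the forward algorithm for a cell filled with `m`, with
labels `ρ` (bottom left), `μ` (bottom right) and `υ` (top left). Partitions are written as
sequences of parts followed by zeros, with parts numbered from `0`. -/
def forwardCarry (m : ℕ) (ρ μ υ : ℕ → ℕ) : ℕ → ℕ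
  | 0 => m
  | i + 1 => min (μ i + forwardCarry m ρ μ υ i) (υ i) - ρ i

/-- The label of the top right corner produced by the forward algorithm. The algorithm may be run
forever instead of stopping at the first zero part: from there on `μ`, `υ` and `CARRY` are zero,
so only zeros follow. -/
def forwardLabel (m : ℕ) (ρ μ υ : ℕ → ℕ) (i : ℕ) : ℕ :=
  max (μ i + forwardCarry m ρ μ υ i) (υ i)

/-- The growth diagram of a `01`-filling: `growthLabel f r c` is the partition (as a sequence of
parts) at the corner at height `r` above the bottom edge and distance `c` from the left edge. Only
the values at corners of cells of `F` are meaningful. -/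
def growthLabel {F : YoungDiagram} (f : Filling01 F) : ℕ → ℕ → ℕ → ℕ
  | 0, _ => fun _ => 0
  | _ + 1, 0 => fun _ => 0
  | r + 1, c + 1 =>
      forwardLabel (f.entry r c) (growthLabel f r c) (growthLabel f r (c + 1))
        (growthLabel f (r + 1) c)

/-- The label of the `t`-th corner, `0 ≤ t ≤ 2n`, on the right/up border of the triangular shape.
The border is traced from the top left `(n, 0)` to the bottom right `(0, n)`; its steps are
alternately to the right and down. -/
def borderLabel {n : ℕ} (f : Filling01 (triangularShape n)) (t : Fin (2 * n + 1)) : ℕ → ℕ :=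
  growthLabel f (n - (t : ℕ) / 2) (((t : ℕ) + 1) / 2)

/-- `ν` is obtained from `μ` by adding a square (so `μ` from `ν` by deleting a square). -/
def AddsSquare (μ ν : YoungDiagram) : Prop :=
  ∃ x, x ∉ μ.cells ∧ ν.cells = insert x μ.cells

/-- The `01`-fillings of the triangular shape with at most one `1` in every row and every column
and without NE-chain of length `k + 1`. -/
def nestingFillings (n k : ℕ) : Set (Filling01 (triangularShape n)) :=
  {f | f.RowsAtMostOne ∧ f.ColsAtMostOne ∧ ¬ f.HasNEChain (k + 1)}

/-- The sequences `(∅ = Λ 0, Λ 1, …, Λ (2n) = ∅)` of partitions, all with at most `k` columns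
(the number of columns is the length of the first row), where `Λ (2i+1)` is obtained from
`Λ (2i)` by doing nothing or adding a square, and `Λ (2i+2)` from `Λ (2i+1)` by doing nothing or
deleting a square. -/
def tableauSequences (n k : ℕ) : Set (Fin (2 * n + 1) → YoungDiagram) :=
  {Λ | Λ 0 = ⊥ ∧ Λ (Fin.last (2 * n)) = ⊥ ∧
    (∀ t, (Λ t).rowLen 0 ≤ k) ∧
    ∀ (i : ℕ) (hi : i < n),
      (Λ ⟨2 * i + 1, by omega⟩ = Λ ⟨2 * i, by omega⟩ ∨
        AddsSquare (Λ ⟨2 * i, by omega⟩) (Λ ⟨2 * i + 1, by omega⟩)) ∧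
      (Λ ⟨2 * i + 2, by omega⟩ = Λ ⟨2 * i + 1, by omega⟩ ∨
        AddsSquare (Λ ⟨2 * i + 2, by omega⟩) (Λ ⟨2 * i + 1, by omega⟩))}

/-! With at most one `1` in every row and column, neighbouring labels of the growth diagram differ
by at most one square, and the forward algorithm collapses to Fomin's local rule with its five
configurations (`LocalRule.cases`). This rule is reversible: the labels `μ`, `υ`, `lam` of a cell
determine its entry and `ρ` (`LocalRule.unique`), and suitable ones exist whenever `lam` exceeds `μ`
and `υ` by at most one square each (`exists_localRule`). Hence the border labels determine the
filling, and every admissible border sequence extends inwards, diagonal by diagonal, to a complete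
labelling. Its labels on the left and bottom edges are empty because labels only shrink towards the
bottom left corner, and the entries found form a partial permutation.

The bound `k` is handled separately: the first part of the label at a corner is the length of the
longest NE-chain in the rectangle below and to the left of it, since both obey the same recursion.
-/

/-- A sequence of parts of an integer partition, extended by zeros. -/
structure IsPartitionSeq (ρ : ℕ → ℕ) : Prop where
  antitone : Antitone ρ
  exists_eq_zero : ∃ N, ρ N = 0

/-- `ρ` and `μ` are partitions, and `μ` is obtained from `ρ` by doing nothing or adding a square. -/
structure AddsAtMostOne (ρ μ : ℕ → ℕ) : Prop where
  left : IsPartitionSeq ρ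
  right : IsPartitionSeq μ
  eq_or : μ = ρ ∨ ∃ a, μ = ρ + Pi.single a 1

/-- `ρ`, `μ`, `υ`, `lam` are the labels of the bottom left, bottom right, top left and top right
corner of a cell with entry `m` in a growth diagram of a partial permutation. -/
structure LocalRule (m : ℕ) (ρ μ υ lam : ℕ → ℕ) : Prop where
  bottom : AddsAtMostOne ρ μ
  left : AddsAtMostOne ρ υ
  entry : m = 0 ∨ m = 1 ∧ μ = ρ ∧ υ = ρ
  label : lam = forwardLabel m ρ μ υ

theorem IsPartitionSeq.zero : IsPartitionSeq (fun _ => 0) :=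
  ⟨antitone_const, 0, rfl⟩

theorem IsPartitionSeq.of_le_of_antitone {ρ μ : ℕ → ℕ} (hμ : IsPartitionSeq μ) (h : ρ ≤ μ)
    (hρ : Antitone ρ) : IsPartitionSeq ρ := by
  obtain ⟨N, hN⟩ := hμ.exists_eq_zero
  exact ⟨hρ, N, Nat.le_zero.1 (hN ▸ h N)⟩

theorem IsPartitionSeq.add_single {ρ : ℕ → ℕ} (h : IsPartitionSeq ρ) (a : ℕ)
    (ha : a = 0 ∨ ∃ b, a = b + 1 ∧ ρ a < ρ b) : IsPartitionSeq (ρ + Pi.single a 1) := by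
  obtain ⟨N, hN⟩ := h.exists_eq_zero
  refine ⟨antitone_nat_of_succ_le fun i => ?_, max N (a + 1), ?_⟩
  · have := h.antitone (Nat.le_succ i)
    simp only [Pi.add_apply, Pi.single_apply]
    rcases ha with rfl | ⟨b, rfl, hb⟩
    · split_ifs <;> simp_all; omega
    · by_cases hib : i = b
      · subst hib; simp; omega
      · split_ifs <;> simp_all; omega
  · have h1 := h.antitone (le_max_left N (a + 1))
    have h2 : max N (a + 1) ≠ a := by omega
    simp [h2]; omega

theorem IsPartitionSeq.lt_of_add_single_succ {ρ : ℕ → ℕ} {b : ℕ}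
    (h : IsPartitionSeq (ρ + Pi.single (b + 1) 1)) : ρ (b + 1) < ρ b := by
  simpa using h.antitone (Nat.le_succ b)

namespace AddsAtMostOne

variable {ρ μ : ℕ → ℕ}

theorem refl (h : IsPartitionSeq ρ) : AddsAtMostOne ρ ρ := ⟨h, h, Or.inl rfl⟩

theorem le (h : AddsAtMostOne ρ μ) : ρ ≤ μ := by
  rcases h.eq_or with rfl | ⟨a, rfl⟩
  · exact le_rfl
  · exact le_self_add

theorem eq_zero (h : AddsAtMostOne ρ μ) (hμ : μ = fun _ => 0) : ρ = fun _ => 0 := by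
  funext i
  have := h.le i
  simp_all

end AddsAtMostOne

/-! ### The forward algorithm on labels differing by at most one square. -/

section Forward

variable {ρ μ υ : ℕ → ℕ} {a b : ℕ}

theorem forwardLabel_one_self : forwardLabel 1 ρ ρ ρ = ρ + Pi.single 0 1 := by
  funext i
  cases i <;> simp [forwardLabel, forwardCarry]

theorem forwardLabel_bottom_eq (h : ρ ≤ υ) : forwardLabel 0 ρ ρ υ = υ := by
  have hc (i : ℕ) : forwardCarry 0 ρ ρ υ i = 0 := by
    induction i with
    | zero => rfl
    | succ i ih => simp [forwardCarry, ih]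
  funext i
  simpa [forwardLabel, hc] using h i

theorem forwardLabel_left_eq (h : ρ ≤ μ) : forwardLabel 0 ρ μ ρ = μ := by
  have hc (i : ℕ) : forwardCarry 0 ρ μ ρ i = 0 := by
    cases i <;> simp [forwardCarry]
  funext i
  simpa [forwardLabel, hc] using h i

/-- In no row do both neighbours exceed `ρ`, so no carry ever arises. -/
theorem forwardLabel_add_single_of_ne (hab : a ≠ b) :
    forwardLabel 0 ρ (ρ + Pi.single a 1) (ρ + Pi.single b 1) =
      ρ + Pi.single a 1 + Pi.single b 1 := by
  have hc (i : ℕ) : forwardCarry 0 ρ (ρ + Pi.single a 1) (ρ + Pi.single b 1) i = 0 := by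
    induction i with
    | zero => rfl
    | succ i ih =>
      simp only [forwardCarry, ih, Pi.add_apply, Pi.single_apply]
      split_ifs <;> omega
  funext i
  simp only [forwardLabel, hc, Pi.add_apply, Pi.single_apply]
  split_ifs <;> omega

/-- The doubled square in row `a` produces a carry of `1`. Row `a + 1` absorbs it, as `υ` agrees
with `ρ` there. -/
theorem forwardLabel_add_single_self :
    forwardLabel 0 ρ (ρ + Pi.single a 1) (ρ + Pi.single a 1) =
      ρ + Pi.single a 1 + Pi.single (a + 1) 1 := by
  have hc (i : ℕ) : forwardCarry 0 ρ (ρ + Pi.single a 1) (ρ + Pi.single a 1) i =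
      if i = a + 1 then 1 else 0 := by
    induction i with
    | zero => simp [forwardCarry]
    | succ i ih =>
      simp only [forwardCarry, ih, Pi.add_apply, Pi.single_apply]
      split_ifs <;> omega
  funext i
  simp only [forwardLabel, hc, Pi.add_apply, Pi.single_apply]
  split_ifs <;> omega

end Forward

theorem add_single_ne_self (ρ : ℕ → ℕ) (a : ℕ) : ρ + Pi.single a 1 ≠ ρ := by
  intro h
  simpa using congrFun h a

theorem add_single_inj {ρ : ℕ → ℕ} {a b : ℕ} :
    ρ + Pi.single a 1 = ρ + Pi.single b 1 ↔ a = b := by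
  refine ⟨fun h => ?_, fun h => h ▸ rfl⟩
  by_contra hab
  simpa [Pi.single_apply, hab] using congrFun h a

/-! ### The local rule and its inversion. -/

namespace LocalRule

variable {m : ℕ} {ρ μ υ lam : ℕ → ℕ}

/-- The five shapes of a cell in the growth diagram of a partial permutation. -/
theorem cases (h : LocalRule m ρ μ υ lam) :
    (m = 1 ∧ μ = ρ ∧ υ = ρ ∧ lam = ρ + Pi.single 0 1) ∨
    (m = 0 ∧ μ = ρ ∧ lam = υ) ∨
    (m = 0 ∧ υ = ρ ∧ lam = μ) ∨
    (∃ a b, m = 0 ∧ a ≠ b ∧ μ = ρ + Pi.single a 1 ∧ υ = ρ + Pi.single b 1 ∧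
      lam = ρ + Pi.single a 1 + Pi.single b 1) ∨
    (∃ a, m = 0 ∧ μ = ρ + Pi.single a 1 ∧ υ = ρ + Pi.single a 1 ∧
      lam = ρ + Pi.single a 1 + Pi.single (a + 1) 1) := by
  have hl := h.label
  rcases h.entry with rfl | ⟨rfl, rfl, rfl⟩
  · rcases h.bottom.eq_or with rfl | ⟨a, rfl⟩
    · rw [forwardLabel_bottom_eq h.left.le] at hl
      exact Or.inr (Or.inl ⟨rfl, rfl, hl⟩)
    · rcases h.left.eq_or with rfl | ⟨b, rfl⟩
      · rw [forwardLabel_left_eq h.bottom.le] at hl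
        exact Or.inr (Or.inr (Or.inl ⟨rfl, rfl, hl⟩))
      · by_cases hab : a = b
        · subst hab
          rw [forwardLabel_add_single_self] at hl
          exact Or.inr (Or.inr (Or.inr (Or.inr ⟨a, rfl, rfl, rfl, hl⟩)))
        · rw [forwardLabel_add_single_of_ne hab] at hl
          exact Or.inr (Or.inr (Or.inr (Or.inl ⟨a, b, rfl, hab, rfl, rfl, hl⟩)))
  · rw [forwardLabel_one_self] at hl
    exact Or.inl ⟨rfl, rfl, rfl, hl⟩

theorem isPartitionSeq (h : LocalRule m ρ μ υ lam) : IsPartitionSeq lam := by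
  rcases h.cases with ⟨-, -, -, rfl⟩ | ⟨-, -, rfl⟩ | ⟨-, -, rfl⟩ | ⟨a, b, -, hab, rfl, rfl, rfl⟩ |
    ⟨a, -, rfl, rfl, rfl⟩
  · exact h.left.left.add_single 0 (Or.inl rfl)
  · exact h.left.right
  · exact h.bottom.right
  · refine h.bottom.right.add_single b ?_
    cases b with
    | zero => exact Or.inl rfl
    | succ b =>
      -- Row `b + 1` of `ρ` is shorter than row `b` because `υ` is a partition; adding a square in a
      -- row other than `b + 1` preserves this.
      have := h.left.right.lt_of_add_single_succ
      refine Or.inr ⟨b, rfl, ?_⟩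
      simp only [Pi.add_apply, Pi.single_apply]
      split_ifs <;> omega
  · refine h.bottom.right.add_single (a + 1) (Or.inr ⟨a, rfl, ?_⟩)
    have := h.left.left.antitone (Nat.le_succ a)
    simp only [Pi.add_apply, Pi.single_apply]
    split_ifs <;> simp_all

theorem right (h : LocalRule m ρ μ υ lam) : AddsAtMostOne μ lam := by
  refine ⟨h.bottom.right, h.isPartitionSeq, ?_⟩
  rcases h.cases with ⟨-, rfl, -, rfl⟩ | ⟨-, rfl, rfl⟩ | ⟨-, -, rfl⟩ |
    ⟨a, b, -, hab, rfl, rfl, rfl⟩ | ⟨a, -, rfl, rfl, rfl⟩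
  · exact Or.inr ⟨_, rfl⟩
  · exact h.left.eq_or
  · exact Or.inl rfl
  · exact Or.inr ⟨_, rfl⟩
  · exact Or.inr ⟨_, rfl⟩

theorem top (h : LocalRule m ρ μ υ lam) : AddsAtMostOne υ lam := by
  refine ⟨h.left.right, h.isPartitionSeq, ?_⟩
  rcases h.cases with ⟨-, -, rfl, rfl⟩ | ⟨-, rfl, rfl⟩ | ⟨-, rfl, rfl⟩ |
    ⟨a, b, -, hab, rfl, rfl, rfl⟩ | ⟨a, -, rfl, rfl, rfl⟩
  · exact Or.inr ⟨_, rfl⟩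
  · exact Or.inl rfl
  · exact h.bottom.eq_or
  · exact Or.inr ⟨a, add_right_comm _ _ _⟩
  · exact Or.inr ⟨_, rfl⟩

theorem of_label_eq_bottom_right (h : LocalRule m ρ μ υ lam) (he : lam = μ) : m = 0 ∧ υ = ρ := by
  rcases h.cases with ⟨-, rfl, -, rfl⟩ | ⟨rfl, rfl, rfl⟩ | ⟨rfl, rfl, -⟩ |
    ⟨a, b, -, hab, rfl, rfl, rfl⟩ | ⟨a, -, rfl, rfl, rfl⟩
  · exact absurd he (add_single_ne_self _ _)
  · exact ⟨rfl, he⟩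
  · exact ⟨rfl, rfl⟩
  · exact absurd he (add_single_ne_self _ _)
  · exact absurd he (add_single_ne_self _ _)

theorem of_label_eq_top_left (h : LocalRule m ρ μ υ lam) (he : lam = υ) : m = 0 ∧ μ = ρ := by
  rcases h.cases with ⟨-, -, rfl, rfl⟩ | ⟨rfl, rfl, -⟩ | ⟨rfl, rfl, rfl⟩ |
    ⟨a, b, -, hab, rfl, rfl, rfl⟩ | ⟨a, -, rfl, rfl, rfl⟩
  · exact absurd he (add_single_ne_self _ _)
  · exact ⟨rfl, rfl⟩
  · exact ⟨rfl, he⟩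
  · rw [add_right_comm] at he
    exact absurd he (add_single_ne_self _ _)
  · exact absurd he (add_single_ne_self _ _)

theorem eq_inf_of_ne (h : LocalRule m ρ μ υ lam) (h1 : lam ≠ μ) (h2 : lam ≠ υ) (h3 : μ ≠ υ) :
    m = 0 ∧ ρ = μ ⊓ υ := by
  rcases h.cases with ⟨-, rfl, rfl, rfl⟩ | ⟨-, -, rfl⟩ | ⟨-, -, rfl⟩ |
    ⟨a, b, rfl, hab, rfl, rfl, -⟩ | ⟨a, -, rfl, rfl, rfl⟩
  · exact absurd rfl h3
  · exact absurd rfl h2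
  · exact absurd rfl h1
  · refine ⟨rfl, funext fun i => ?_⟩
    simp only [Pi.inf_apply, Pi.add_apply, Pi.single_apply]
    split_ifs <;> omega
  · exact absurd rfl h3

theorem of_add_single_zero (h : LocalRule m ρ μ μ (μ + Pi.single 0 1)) : m = 1 ∧ ρ = μ := by
  rcases h.cases with ⟨rfl, rfl, -, -⟩ | ⟨-, -, he⟩ | ⟨-, -, he⟩ |
    ⟨a, b, -, hab, he, he', -⟩ | ⟨a, -, rfl, -, he⟩
  · exact ⟨rfl, rfl⟩
  · exact absurd he (add_single_ne_self _ _)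
  · exact absurd he (add_single_ne_self _ _)
  · exact absurd (add_single_inj.1 (he.symm.trans he')) hab
  · exact absurd (add_single_inj.1 he) (by omega)

theorem of_add_single_succ {b : ℕ} (h : LocalRule m ρ μ μ (μ + Pi.single (b + 1) 1)) :
    m = 0 ∧ μ = ρ + Pi.single b 1 := by
  rcases h.cases with ⟨-, rfl, -, he⟩ | ⟨-, -, he⟩ | ⟨-, -, he⟩ |
    ⟨a, b, -, hab, he, he', -⟩ | ⟨a, rfl, rfl, -, he⟩
  · exact absurd (add_single_inj.1 he) (by omega)
  · exact absurd he (add_single_ne_self _ _)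
  · exact absurd he (add_single_ne_self _ _)
  · exact absurd (add_single_inj.1 (he.symm.trans he')) hab
  · obtain rfl : b = a := by have := add_single_inj.1 he; omega
    exact ⟨rfl, rfl⟩

/-- The labels at the other three corners of a cell determine its entry and the label of its
bottom left corner. -/
theorem unique {m' : ℕ} {ρ' : ℕ → ℕ} (h : LocalRule m ρ μ υ lam) (h' : LocalRule m' ρ' μ υ lam) :
    m = m' ∧ ρ = ρ' := by
  by_cases h1 : lam = μ
  · obtain ⟨rfl, rfl⟩ := h.of_label_eq_bottom_right h1
    obtain ⟨rfl, rfl⟩ := h'.of_label_eq_bottom_right h1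
    exact ⟨rfl, rfl⟩
  by_cases h2 : lam = υ
  · obtain ⟨rfl, rfl⟩ := h.of_label_eq_top_left h2
    obtain ⟨rfl, rfl⟩ := h'.of_label_eq_top_left h2
    exact ⟨rfl, rfl⟩
  by_cases h3 : μ = υ
  · subst h3
    obtain ⟨a, rfl⟩ := h.right.eq_or.resolve_left h1
    cases a with
    | zero =>
      obtain ⟨rfl, rfl⟩ := h.of_add_single_zero
      obtain ⟨rfl, rfl⟩ := h'.of_add_single_zero
      exact ⟨rfl, rfl⟩
    | succ b =>
      obtain ⟨rfl, e⟩ := h.of_add_single_succ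
      obtain ⟨rfl, e'⟩ := h'.of_add_single_succ
      exact ⟨rfl, add_right_cancel (e.symm.trans e')⟩
  · obtain ⟨rfl, rfl⟩ := h.eq_inf_of_ne h1 h2 h3
    obtain ⟨rfl, rfl⟩ := h'.eq_inf_of_ne h1 h2 h3
    exact ⟨rfl, rfl⟩

end LocalRule

/-- The growth rule can be run backwards. -/
theorem exists_localRule (μ υ lam : ℕ → ℕ) (hμ : AddsAtMostOne μ lam) (hυ : AddsAtMostOne υ lam) :
    ∃ m ρ, LocalRule m ρ μ υ lam := by
  rcases hμ.eq_or with rfl | ⟨a, hla⟩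
  · exact ⟨0, υ, hυ, .refl hυ.left, Or.inl rfl, (forwardLabel_left_eq hυ.le).symm⟩
  rcases hυ.eq_or with rfl | ⟨b, hlb⟩
  · exact ⟨0, μ, .refl hμ.left, hμ, Or.inl rfl, (forwardLabel_bottom_eq hμ.le).symm⟩
  by_cases hab : a = b
  · subst hab
    obtain rfl : μ = υ := add_right_cancel (hla.symm.trans hlb)
    subst hla
    cases a with
    | zero =>
      exact ⟨1, μ, .refl hμ.left, .refl hμ.left, Or.inr ⟨rfl, rfl, rfl⟩,
        forwardLabel_one_self.symm⟩
    | succ b =>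
      -- As `lam` is a partition, `μ` has a removable square in row `b`. Deleting it gives `ρ`, and
      -- the carry recreates the square of row `b + 1`.
      have hlt := hμ.right.lt_of_add_single_succ
      obtain ⟨ρ, rfl⟩ : ∃ ρ, μ = ρ + Pi.single b 1 := by
        refine ⟨μ - Pi.single b 1, (tsub_add_cancel_of_le fun i => ?_).symm⟩
        simp only [Pi.single_apply]
        split_ifs with hi
        · subst hi; omega
        · omega
      have hρ : IsPartitionSeq ρ := by
        refine hμ.left.of_le_of_antitone le_self_add (antitone_nat_of_succ_le fun i => ?_)
        have := hμ.left.antitone (Nat.le_succ i)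
        simp only [Pi.add_apply, Pi.single_apply, Nat.succ_eq_add_one] at this hlt
        by_cases hi : i = b
        · subst hi
          simp at hlt
          omega
        · simp only [hi, if_false] at this
          split_ifs at this <;> omega
      have h : AddsAtMostOne ρ (ρ + Pi.single b 1) := ⟨hρ, hμ.left, Or.inr ⟨b, rfl⟩⟩
      exact ⟨0, ρ, h, h, Or.inl rfl, forwardLabel_add_single_self.symm⟩
  · have he (i : ℕ) := congrFun (hla.symm.trans hlb) i
    simp only [Pi.add_apply, Pi.single_apply] at he
    -- The indices cross over: `μ` lacks the square of row `a`, hence contains that of row `b`, and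
    -- vice versa for `υ`.
    have h1 : μ = μ ⊓ υ + Pi.single b 1 := by
      funext i
      have := he i
      simp only [Pi.add_apply, Pi.inf_apply, Pi.single_apply]
      split_ifs at this ⊢ <;> omega
    have h2 : υ = μ ⊓ υ + Pi.single a 1 := by
      funext i
      have := he i
      simp only [Pi.add_apply, Pi.inf_apply, Pi.single_apply]
      split_ifs at this ⊢ <;> omega
    have hρ : IsPartitionSeq (μ ⊓ υ) :=
      hμ.left.of_le_of_antitone inf_le_left (hμ.left.antitone.inf hυ.left.antitone)
    refine ⟨0, μ ⊓ υ, ⟨hρ, hμ.left, Or.inr ⟨b, h1⟩⟩, ⟨hρ, hυ.left, Or.inr ⟨a, h2⟩⟩, Or.inl rfl, ?_⟩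
    generalize μ ⊓ υ = ρ at h1 h2
    subst h1 h2
    rw [forwardLabel_add_single_of_ne (Ne.symm hab), hla]

/-! ### Translation between Young diagrams and sequences of parts. -/

section YoungDiagram

theorem IsPartitionSeq.exists_youngDiagram {ρ : ℕ → ℕ} (h : IsPartitionSeq ρ) :
    ∃ μ : YoungDiagram, ∀ i, μ.rowLen i = ρ i := by
  obtain ⟨N, hN⟩ := h.exists_eq_zero
  have key (i j : ℕ) (hj : j < ρ i) : i < N ∧ j < ρ 0 := by
    refine ⟨?_, hj.trans_le (h.antitone (Nat.zero_le i))⟩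
    by_contra hi
    have := h.antitone (not_lt.1 hi)
    omega
  refine ⟨⟨(Finset.range N ×ˢ Finset.range (ρ 0)).filter fun x => x.2 < ρ x.1, ?_⟩, fun i => ?_⟩
  · rintro ⟨a, b⟩ ⟨c, d⟩ ⟨h1, h2⟩ hab
    simp only [Finset.coe_filter, Finset.mem_product, Finset.mem_range, Set.mem_ofPred_eq]
      at hab ⊢
    simp only at h1 h2
    have hlt : d < ρ c := (h2.trans_lt hab.2).trans_le (h.antitone h1)
    exact ⟨key _ _ hlt, hlt⟩
  · refine eq_of_forall_lt_iff fun j => ?_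
    rw [← YoungDiagram.mem_iff_lt_rowLen, ← YoungDiagram.mem_cells]
    simp only [Finset.mem_filter, Finset.mem_product, Finset.mem_range]
    exact ⟨fun h => h.2, fun h => ⟨key _ _ h, h⟩⟩

theorem YoungDiagram.ext_rowLen {μ ν : YoungDiagram} (h : ∀ i, μ.rowLen i = ν.rowLen i) :
    μ = ν := by
  ext ⟨i, j⟩
  rw [YoungDiagram.mem_cells, YoungDiagram.mem_cells, YoungDiagram.mem_iff_lt_rowLen,
    YoungDiagram.mem_iff_lt_rowLen, h]

theorem YoungDiagram.isPartitionSeq_rowLen (μ : YoungDiagram) : IsPartitionSeq μ.rowLen := by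
  refine ⟨fun i j h => μ.rowLen_anti i j h, μ.colLen 0, ?_⟩
  by_contra h
  exact lt_irrefl _ (YoungDiagram.mem_iff_lt_colLen.1
    (YoungDiagram.mem_iff_lt_rowLen.2 (Nat.pos_of_ne_zero h)))

theorem YoungDiagram.rowLen_bot (i : ℕ) : (⊥ : YoungDiagram).rowLen i = 0 := by
  by_contra h
  exact YoungDiagram.notMem_bot _ (YoungDiagram.mem_iff_lt_rowLen.2 (Nat.pos_of_ne_zero h))

theorem addsSquare_iff_rowLen {μ ν : YoungDiagram} :
    AddsSquare μ ν ↔ ∃ a, ν.rowLen = μ.rowLen + Pi.single a 1 := by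
  constructor
  · rintro ⟨⟨a, b⟩, hx, hν⟩
    have hmem (i j : ℕ) : j < ν.rowLen i ↔ (i = a ∧ j = b) ∨ j < μ.rowLen i := by
      rw [← YoungDiagram.mem_iff_lt_rowLen, ← YoungDiagram.mem_cells, hν, Finset.mem_insert,
        Prod.mk.injEq, YoungDiagram.mem_cells, YoungDiagram.mem_iff_lt_rowLen]
    rw [YoungDiagram.mem_cells, YoungDiagram.mem_iff_lt_rowLen] at hx
    -- Otherwise the cell just after the end of row `a` of `μ` would be a further new cell, since
    -- the rows of `ν` have no gaps.
    have hb : b = μ.rowLen a := by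
      have h1 := (hmem a b).2 (Or.inl ⟨rfl, rfl⟩)
      have h2 := (hmem a (μ.rowLen a)).1 (by omega)
      omega
    refine ⟨a, funext fun i => eq_of_forall_lt_iff fun j => ?_⟩
    rw [hmem, Pi.add_apply, Pi.single_apply]
    split_ifs with hi
    · subst hi; omega
    · omega
  · rintro ⟨a, h⟩
    refine ⟨(a, μ.rowLen a), ?_, ?_⟩
    · rw [YoungDiagram.mem_cells, YoungDiagram.mem_iff_lt_rowLen]
      exact lt_irrefl _
    · ext ⟨i, j⟩
      rw [Finset.mem_insert, YoungDiagram.mem_cells, YoungDiagram.mem_cells,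
        YoungDiagram.mem_iff_lt_rowLen, YoungDiagram.mem_iff_lt_rowLen, h, Pi.add_apply,
        Pi.single_apply, Prod.mk.injEq]
      split_ifs with hi
      · subst hi; omega
      · omega

theorem addsAtMostOne_rowLen_iff {μ ν : YoungDiagram} :
    AddsAtMostOne μ.rowLen ν.rowLen ↔ ν = μ ∨ AddsSquare μ ν := by
  rw [addsSquare_iff_rowLen]
  constructor
  · intro h
    exact h.eq_or.imp_left fun h => YoungDiagram.ext_rowLen (congrFun h)
  · intro h
    exact ⟨μ.isPartitionSeq_rowLen, ν.isPartitionSeq_rowLen, h.imp_left (congrArg YoungDiagram.rowLen)⟩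

theorem mem_triangularShape {n r c : ℕ} : (r, c) ∈ (triangularShape n).cells ↔ r + c < n := by
  simp only [triangularShape, Finset.mem_filter, Finset.mem_product, Finset.mem_range]
  omega

end YoungDiagram

/-! ### Local structure of growth diagrams of partial permutations. -/

section Growth

variable {F : YoungDiagram} {f : Filling01 F}

theorem Filling01.entry_eq_one_iff {r c : ℕ} :
    f.entry r c = 1 ↔ ∃ h : (r, c) ∈ F.cells, f ⟨(r, c), h⟩ = 1 := by
  unfold Filling01.entry
  split_ifs with h
  · simp [h, Fin.ext_iff]
  · simp [h]

theorem Filling01.entry_eq_zero_or (r c : ℕ) : f.entry r c = 0 ∨ f.entry r c = 1 := by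
  unfold Filling01.entry
  split_ifs with h
  · omega
  · exact Or.inl rfl

theorem Filling01.RowsAtMostOne.col_eq (h : f.RowsAtMostOne) {r c c' : ℕ} (h1 : f.entry r c = 1)
    (h2 : f.entry r c' = 1) : c = c' := by
  obtain ⟨hx, h1⟩ := Filling01.entry_eq_one_iff.1 h1
  obtain ⟨hy, h2⟩ := Filling01.entry_eq_one_iff.1 h2
  simpa using h _ _ h1 h2 rfl

theorem Filling01.ColsAtMostOne.row_eq (h : f.ColsAtMostOne) {r r' c : ℕ} (h1 : f.entry r c = 1)
    (h2 : f.entry r' c = 1) : r = r' := by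
  obtain ⟨hx, h1⟩ := Filling01.entry_eq_one_iff.1 h1
  obtain ⟨hy, h2⟩ := Filling01.entry_eq_one_iff.1 h2
  simpa using h _ _ h1 h2 rfl

theorem growthLabel_zero_left (c : ℕ) : growthLabel f 0 c = fun _ => 0 := by
  rw [growthLabel]

theorem growthLabel_zero_right (r : ℕ) : growthLabel f r 0 = fun _ => 0 := by
  cases r <;> rw [growthLabel]

theorem growthLabel_succ_succ (r c : ℕ) : growthLabel f (r + 1) (c + 1) =
    forwardLabel (f.entry r c) (growthLabel f r c) (growthLabel f r (c + 1))
      (growthLabel f (r + 1) c) := by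
  rw [growthLabel]

/-- The labels at the ends of the `r`-th horizontal edge in column `c` differ by at most one
square, and are equal if there is no `1` below that edge. -/
def HorizontalStep (f : Filling01 F) (r c : ℕ) : Prop :=
  AddsAtMostOne (growthLabel f r c) (growthLabel f r (c + 1)) ∧
    ((∀ r' < r, f.entry r' c = 0) → growthLabel f r (c + 1) = growthLabel f r c)

/-- The labels at the ends of the `c`-th vertical edge in row `r` differ by at most one square, and
are equal if there is no `1` to the left of that edge. -/
def VerticalStep (f : Filling01 F) (r c : ℕ) : Prop :=
  AddsAtMostOne (growthLabel f r c) (growthLabel f (r + 1) c) ∧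
    ((∀ c' < c, f.entry r c' = 0) → growthLabel f (r + 1) c = growthLabel f r c)

/-- A `1` in the cell excludes any other `1` below it or to its left, so the bottom and left edges
carry equal labels. -/
theorem localRule_of_steps (hr : f.RowsAtMostOne) (hc : f.ColsAtMostOne) {r c : ℕ}
    (hH : HorizontalStep f r c) (hV : VerticalStep f r c) :
    LocalRule (f.entry r c) (growthLabel f r c) (growthLabel f r (c + 1))
      (growthLabel f (r + 1) c) (growthLabel f (r + 1) (c + 1)) := by
  refine ⟨hH.1, hV.1, (Filling01.entry_eq_zero_or r c).imp_right fun h => ⟨h, hH.2 ?_, hV.2 ?_⟩,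
    growthLabel_succ_succ r c⟩
  · intro r' hr'
    exact (Filling01.entry_eq_zero_or r' c).resolve_right fun h' => hr'.ne (hc.row_eq h' h)
  · intro c' hc'
    exact (Filling01.entry_eq_zero_or r c').resolve_right fun h' => hc'.ne (hr.col_eq h' h)

theorem HorizontalStep.succ (hr : f.RowsAtMostOne) (hc : f.ColsAtMostOne) {r c : ℕ}
    (hH : HorizontalStep f r c) (hV : VerticalStep f r c) : HorizontalStep f (r + 1) c := by
  refine ⟨(localRule_of_steps hr hc hH hV).top, fun h => ?_⟩
  rw [growthLabel_succ_succ, h r (Nat.lt_succ_self r), hH.2 fun r' hr' => h r' (by omega),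
    forwardLabel_bottom_eq hV.1.le]

theorem VerticalStep.succ (hr : f.RowsAtMostOne) (hc : f.ColsAtMostOne) {r c : ℕ}
    (hH : HorizontalStep f r c) (hV : VerticalStep f r c) : VerticalStep f r (c + 1) := by
  refine ⟨(localRule_of_steps hr hc hH hV).right, fun h => ?_⟩
  rw [growthLabel_succ_succ, h c (Nat.lt_succ_self c), hV.2 fun c' hc' => h c' (by omega),
    forwardLabel_left_eq hH.1.le]

theorem horizontalStep_and_verticalStep (hr : f.RowsAtMostOne) (hc : f.ColsAtMostOne) (r : ℕ) :
    ∀ c, HorizontalStep f r c ∧ VerticalStep f r c := by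
  -- Within a row of cells, the vertical edges follow from the horizontal edges below by moving
  -- right from the empty left border.
  have key (r : ℕ) (h : ∀ c, HorizontalStep f r c) (c : ℕ) :
      HorizontalStep f r c ∧ VerticalStep f r c := by
    refine ⟨h c, ?_⟩
    induction c with
    | zero =>
      rw [VerticalStep, growthLabel_zero_right, growthLabel_zero_right]
      exact ⟨.refl .zero, fun _ => rfl⟩
    | succ c ih => exact ih.succ hr hc (h c)
  induction r with
  | zero =>
    refine key 0 fun c => ?_
    rw [HorizontalStep, growthLabel_zero_left, growthLabel_zero_left]
    exact ⟨.refl .zero, fun _ => rfl⟩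
  | succ r ih => exact key _ fun c => (ih c).1.succ hr hc (ih c).2

theorem localRule_growthLabel (hr : f.RowsAtMostOne) (hc : f.ColsAtMostOne) (r c : ℕ) :
    LocalRule (f.entry r c) (growthLabel f r c) (growthLabel f r (c + 1))
      (growthLabel f (r + 1) c) (growthLabel f (r + 1) (c + 1)) :=
  have h := horizontalStep_and_verticalStep hr hc r c
  localRule_of_steps hr hc h.1 h.2

end Growth

/-! ### First parts of labels and NE-chains. -/

section Chains

variable {F : YoungDiagram} {f : Filling01 F}

/-- There is a NE-chain of length `l` in the lowest `r` rows and leftmost `c` columns. -/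
def HasNEChainIn (f : Filling01 F) (l r c : ℕ) : Prop :=
  ∃ x : Fin l → ℕ × ℕ, (∀ s, f.entry (x s).1 (x s).2 = 1 ∧ (x s).1 < r ∧ (x s).2 < c) ∧
    ∀ s t, s < t → (x s).1 < (x t).1 ∧ (x s).2 ≤ (x t).2

theorem HasNEChainIn.mono {l r c r' c' : ℕ} (h : HasNEChainIn f l r c) (hr : r ≤ r')
    (hc : c ≤ c') : HasNEChainIn f l r' c' := by
  obtain ⟨x, hx, hlt⟩ := h
  exact ⟨x, fun s => ⟨(hx s).1, (hx s).2.1.trans_le hr, (hx s).2.2.trans_le hc⟩, hlt⟩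

theorem HasNEChainIn.hasNEChain {l r c : ℕ} (h : HasNEChainIn f l r c) : f.HasNEChain l := by
  obtain ⟨x, hx, hlt⟩ := h
  choose hm h1 using fun s => Filling01.entry_eq_one_iff.1 (hx s).1
  exact ⟨fun s => ⟨x s, hm s⟩, h1, hlt⟩

theorem Filling01.HasNEChain.exists_hasNEChainIn {l : ℕ} (h : f.HasNEChain (l + 1)) :
    ∃ r c, (r, c) ∈ F.cells ∧ HasNEChainIn f (l + 1) (r + 1) (c + 1) := by
  obtain ⟨x, hx, hlt⟩ := h
  refine ⟨(x (Fin.last l)).1.1, (x (Fin.last l)).1.2, (x (Fin.last l)).2, fun s => (x s).1,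
    fun s => ⟨Filling01.entry_eq_one_iff.2 ⟨(x s).2, hx s⟩, ?_⟩, hlt⟩
  rcases (Fin.le_last s).eq_or_lt with h | h
  · subst h; exact ⟨Nat.lt_succ_self _, Nat.lt_succ_self _⟩
  · have := hlt _ _ h
    exact ⟨this.1.trans (Nat.lt_succ_self _), Nat.lt_succ_of_le this.2⟩

/-- The first part obeys `max (μ 0 + m) (υ 0)`. A chain avoiding the last column is counted by `υ
0`; one avoiding the top row, by `μ 0`; any other ends in the corner cell. -/
theorem HasNEChainIn.le_growthLabel (r : ℕ) :
    ∀ {c l : ℕ}, HasNEChainIn f l r c → l ≤ growthLabel f r c 0 := by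
  induction r with
  | zero =>
    rintro c l ⟨x, hx, -⟩
    cases l with
    | zero => exact Nat.zero_le _
    | succ l => exact absurd (hx 0).2.1 (Nat.not_lt_zero _)
  | succ r ihr =>
    intro c
    induction c with
    | zero =>
      rintro l ⟨x, hx, -⟩
      cases l with
      | zero => exact Nat.zero_le _
      | succ l => exact absurd (hx 0).2.2 (Nat.not_lt_zero _)
    | succ c ihc =>
      rintro l ⟨x, hx, hlt⟩
      cases l with
      | zero => exact Nat.zero_le _
      | succ l =>
        rw [growthLabel_succ_succ, forwardLabel, forwardCarry, le_max_iff]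
        have hlast := hx (Fin.last l)
        have hle (s : Fin (l + 1)) : (x s).2 ≤ (x (Fin.last l)).2 := by
          rcases (Fin.le_last s).eq_or_lt with h | h
          · rw [h]
          · exact (hlt _ _ h).2
        by_cases hcl : (x (Fin.last l)).2 < c
        · exact Or.inr (ihc ⟨x, fun s => ⟨(hx s).1, (hx s).2.1, (hle s).trans_lt hcl⟩, hlt⟩)
        left
        by_cases hrl : (x (Fin.last l)).1 < r
        · refine (ihr (l := l + 1) (c := c + 1) ⟨x, fun s => ⟨(hx s).1, ?_, (hx s).2.2⟩, hlt⟩).trans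
            (Nat.le_add_right _ _)
          rcases (Fin.le_last s).eq_or_lt with h | h
          · rwa [h]
          · exact (hlt _ _ h).1.trans hrl
        have h1 : f.entry r c = 1 := by
          rw [← hlast.1]
          congr 1 <;> omega
        rw [h1]
        -- Without its last cell the chain lies strictly below row `r`, but may still use column
        -- `c`.
        refine Nat.succ_le_succ (ihr (l := l) (c := c + 1) ⟨fun s => x s.castSucc,
          fun s => ⟨(hx _).1, ?_, (hx _).2.2⟩, fun s t h => hlt _ _ (by simpa using h)⟩)
        have := (hlt _ _ (Fin.castSucc_lt_last s)).1
        exact this.trans_le (Nat.le_of_lt_succ hlast.2.1)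

theorem hasNEChainIn_of_le_growthLabel (r : ℕ) :
    ∀ {c l : ℕ}, l ≤ growthLabel f r c 0 → HasNEChainIn f l r c := by
  have zero (r c : ℕ) : HasNEChainIn f 0 r c := ⟨Fin.elim0, fun s => s.elim0, fun s => s.elim0⟩
  induction r with
  | zero =>
    intro c l h
    rw [growthLabel_zero_left] at h
    obtain rfl := Nat.le_zero.1 h
    exact zero _ _
  | succ r ihr =>
    intro c
    induction c with
    | zero =>
      intro l h
      rw [growthLabel_zero_right] at h
      obtain rfl := Nat.le_zero.1 h
      exact zero _ _
    | succ c ihc =>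
      intro l h
      rw [growthLabel_succ_succ, forwardLabel, forwardCarry, le_max_iff] at h
      rcases h with h | h
      · rcases Filling01.entry_eq_zero_or (f := f) r c with h0 | h1
        · exact (ihr (by omega)).mono (Nat.le_succ r) le_rfl
        · cases l with
          | zero => exact zero _ _
          | succ l =>
            obtain ⟨x, hx, hlt⟩ := ihr (c := c + 1) (l := l) (by omega)
            refine ⟨Fin.snoc x (r, c), fun s => ?_, fun s t hst => ?_⟩
            · cases s using Fin.lastCases with
              | last => simpa using h1
              | cast s =>
                have := hx s
                simp only [Fin.snoc_castSucc]
                exact ⟨this.1, this.2.1.trans (Nat.lt_succ_self r), this.2.2⟩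
            · cases s using Fin.lastCases with
              | last => exact absurd hst (Fin.le_last t).not_gt
              | cast s =>
                cases t using Fin.lastCases with
                | last =>
                  simp only [Fin.snoc_castSucc, Fin.snoc_last]
                  exact ⟨(hx s).2.1, Nat.le_of_lt_succ (hx s).2.2⟩
                | cast t =>
                  simp only [Fin.snoc_castSucc]
                  exact hlt s t (by simpa using hst)
      · exact (ihc h).mono le_rfl (Nat.le_succ c)

end Chains

/-! ### The triangular shape: reading the border and running the rule backwards. -/

section Triangle

variable {n k : ℕ}

theorem borderLabel_eq (f : Filling01 (triangularShape n)) {r c t : ℕ} (ht : t < 2 * n + 1)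
    (hr : n - t / 2 = r) (hc : (t + 1) / 2 = c) : borderLabel f ⟨t, ht⟩ = growthLabel f r c := by
  rw [borderLabel, hr, hc]

theorem not_hasNEChain_iff_borderLabel_le (f : Filling01 (triangularShape n)) :
    ¬ f.HasNEChain (k + 1) ↔ ∀ t, borderLabel f t 0 ≤ k := by
  constructor
  · intro h t
    by_contra ht
    exact h (hasNEChainIn_of_le_growthLabel _ (Nat.lt_of_not_le ht)).hasNEChain
  · intro h hch
    obtain ⟨r, c, hrc, hch⟩ := hch.exists_hasNEChainIn
    rw [mem_triangularShape] at hrc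
    have h1 := (hch.mono le_rfl (show c + 1 ≤ n - r by omega)).le_growthLabel
    -- This is the outer corner at the right end of row `r`; its rectangle contains the chain.
    have h2 := h ⟨2 * (n - r) - 1, by omega⟩
    rw [borderLabel_eq f (r := r + 1) (c := n - r) _ (by omega) (by omega)] at h2
    omega

theorem exists_tableauSequence {f : Filling01 (triangularShape n)} (hf : f ∈ nestingFillings n k) :
    ∃ Λ ∈ tableauSequences n k, ∀ t i, (Λ t).rowLen i = borderLabel f t i := by
  obtain ⟨hr, hc, hch⟩ := hf
  have hs (r c : ℕ) := horizontalStep_and_verticalStep hr hc r c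
  choose Λ hΛ using fun t : Fin (2 * n + 1) =>
    (show IsPartitionSeq (borderLabel f t) from (hs _ _).1.1.left).exists_youngDiagram
  have hΛ' {t r c : ℕ} (ht : t < 2 * n + 1) (hr : n - t / 2 = r) (hc : (t + 1) / 2 = c) :
      (Λ ⟨t, ht⟩).rowLen = growthLabel f r c := by
    rw [← borderLabel_eq f ht hr hc]
    exact funext (hΛ _)
  refine ⟨Λ, ⟨?_, ?_, fun t => ?_, fun i hi => ⟨?_, ?_⟩⟩, hΛ⟩
  · refine YoungDiagram.ext_rowLen fun i => ?_
    rw [YoungDiagram.rowLen_bot]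
    exact (congrFun (hΛ' (t := 0) (r := n) (c := 0) (by omega) (by omega) (by omega)) i).trans
      (congrFun (growthLabel_zero_right n) i)
  · refine YoungDiagram.ext_rowLen fun i => ?_
    rw [YoungDiagram.rowLen_bot]
    exact (congrFun (hΛ' (t := 2 * n) (r := 0) (c := n) (by omega) (by omega) (by omega)) i).trans
      (congrFun (growthLabel_zero_left n) i)
  · rw [hΛ]
    exact (not_hasNEChain_iff_borderLabel_le f).1 hch t
  · rw [← addsAtMostOne_rowLen_iff, hΛ' (r := n - i) (c := i) _ (by omega) (by omega),
      hΛ' (r := n - i) (c := i + 1) _ (by omega) (by omega)]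
    exact (hs _ _).1.1
  · refine (addsAtMostOne_rowLen_iff.1 ?_).imp_left Eq.symm
    rw [hΛ' (r := n - (i + 1)) (c := i + 1) _ (by omega) (by omega),
      hΛ' (r := n - (i + 1) + 1) (c := i + 1) _ (by omega) (by omega)]
    exact (hs _ _).2.1

theorem eq_of_borderLabel_eq {f f' : Filling01 (triangularShape n)} (hr : f.RowsAtMostOne)
    (hc : f.ColsAtMostOne) (hr' : f'.RowsAtMostOne) (hc' : f'.ColsAtMostOne)
    (h : ∀ t, borderLabel f t = borderLabel f' t) : f = f' := by
  have hb {r c : ℕ} (t : ℕ) (ht : t < 2 * n + 1) (hr : n - t / 2 = r) (hc : (t + 1) / 2 = c) :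
      growthLabel f r c = growthLabel f' r c := by
    rw [← borderLabel_eq f ht hr hc, ← borderLabel_eq f' ht hr hc, h]
  have hu {r c : ℕ} (h1 : growthLabel f r (c + 1) = growthLabel f' r (c + 1))
      (h2 : growthLabel f (r + 1) c = growthLabel f' (r + 1) c)
      (h3 : growthLabel f (r + 1) (c + 1) = growthLabel f' (r + 1) (c + 1)) :
      f.entry r c = f'.entry r c ∧ growthLabel f r c = growthLabel f' r c := by
    have := localRule_growthLabel hr' hc' r c
    rw [← h1, ← h2, ← h3] at this
    exact (localRule_growthLabel hr hc r c).unique this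
  -- Here `d` numbers the diagonals inwards: `0` holds the outer corners of the border, `1` its
  -- remaining corners, and each later diagonal follows from the two before it.
  have hg (d : ℕ) : ∀ r c, r ≤ n → c ≤ n → r + c + d = n + 1 →
      growthLabel f r c = growthLabel f' r c := by
    induction d using Nat.strong_induction_on with
    | _ d ih =>
      intro r c hrn hcn hd
      match d with
      | 0 => exact hb (2 * c - 1) (by omega) (by omega) (by omega)
      | 1 => exact hb (2 * c) (by omega) (by omega) (by omega)
      | d + 2 =>
        exact (hu (ih (d + 1) (by omega) _ _ (by omega) (by omega) (by omega))
          (ih (d + 1) (by omega) _ _ (by omega) (by omega) (by omega))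
          (ih d (by omega) _ _ (by omega) (by omega) (by omega))).2
  funext ⟨⟨r, c⟩, hx⟩
  have hrc := mem_triangularShape.1 hx
  have := (hu (hg (n - (r + c)) r (c + 1) (by omega) (by omega) (by omega))
    (hg (n - (r + c)) (r + 1) c (by omega) (by omega) (by omega))
    (hg (n - (r + c) - 1) (r + 1) (c + 1) (by omega) (by omega) (by omega))).1
  simpa [Filling01.entry, hx, Fin.ext_iff] using this

/-- The labels found from the labels `L 0, …, L (2n)` on the border by running the growth rule `R`
backwards, at the `d`-th diagonal below the outer corners and in column `c`. -/
def backwardLabel (R : (ℕ → ℕ) → (ℕ → ℕ) → (ℕ → ℕ) → ℕ → ℕ) (L : ℕ → ℕ → ℕ) :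
    ℕ → ℕ → ℕ → ℕ
  | 0, c => L (2 * c - 1)
  | 1, c => L (2 * c)
  | d + 2, c => R (backwardLabel R L (d + 1) (c + 1)) (backwardLabel R L (d + 1) c)
      (backwardLabel R L d (c + 1))

theorem exists_labelling (n : ℕ) (L : ℕ → ℕ → ℕ) (h0 : L 0 = fun _ => 0)
    (hn : L (2 * n) = fun _ => 0)
    (hL : ∀ i < n, AddsAtMostOne (L (2 * i)) (L (2 * i + 1)) ∧
      AddsAtMostOne (L (2 * i + 2)) (L (2 * i + 1))) :
    ∃ (m : ℕ → ℕ → ℕ) (G : ℕ → ℕ → ℕ → ℕ),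
      (∀ r c, r + c < n →
        LocalRule (m r c) (G r c) (G r (c + 1)) (G (r + 1) c) (G (r + 1) (c + 1))) ∧
      (∀ c ≤ n, G 0 c = fun _ => 0) ∧ (∀ r ≤ n, G r 0 = fun _ => 0) ∧
      ∀ t ≤ 2 * n, G (n - t / 2) ((t + 1) / 2) = L t := by
  -- `M` and `R` are total functions, meaningful only on admissible triples; `hstep` ensures that
  -- only such triples matter.
  choose! M R hR using exists_localRule
  let H := backwardLabel R L
  have hstep (d : ℕ) : ∀ c, d + c < n →
      AddsAtMostOne (H (d + 1) (c + 1)) (H d (c + 1)) ∧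
      AddsAtMostOne (H (d + 1) c) (H d (c + 1)) := by
    induction d with
    | zero =>
      intro c hc
      exact ⟨(hL c (by omega)).2, (hL c (by omega)).1⟩
    | succ d ih =>
      intro c hc
      have h1 := ih c (by omega)
      have h2 := ih (c + 1) (by omega)
      exact ⟨(hR _ _ _ h2.1 h2.2).left, (hR _ _ _ h1.1 h1.2).bottom⟩
  have hG (r c : ℕ) (hrc : r + c < n) : LocalRule
      (M (H (n + 1 - (r + (c + 1))) (c + 1)) (H (n + 1 - (r + 1 + c)) c)
        (H (n + 1 - (r + 1 + (c + 1))) (c + 1)))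
      (H (n + 1 - (r + c)) c) (H (n + 1 - (r + (c + 1))) (c + 1))
      (H (n + 1 - (r + 1 + c)) c) (H (n + 1 - (r + 1 + (c + 1))) (c + 1)) := by
    obtain ⟨d, rfl⟩ : ∃ d, n = r + c + d + 1 := ⟨n - (r + c) - 1, by omega⟩
    have h := hstep d c (by omega)
    rw [show r + c + d + 1 + 1 - (r + c) = d + 2 by omega,
      show r + c + d + 1 + 1 - (r + (c + 1)) = d + 1 by omega,
      show r + c + d + 1 + 1 - (r + 1 + c) = d + 1 by omega,
      show r + c + d + 1 + 1 - (r + 1 + (c + 1)) = d by omega]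
    exact hR _ _ _ h.1 h.2
  refine ⟨_, fun r c => H (n + 1 - (r + c)) c, hG, fun c hc => ?_, fun r hr => ?_,
    fun t ht => ?_⟩
  -- The label at the right end of the bottom edge is empty, and labels shrink to the left; the left
  -- edge is analogous.
  · induction hc using Nat.decreasingInduction with
    | self =>
      simp only [Nat.zero_add, Nat.add_sub_cancel_left]
      exact hn
    | of_succ c hc ih => exact (hG 0 c (by omega)).bottom.eq_zero ih
  · induction hr using Nat.decreasingInduction with
    | self =>
      simp only [Nat.add_zero, Nat.add_sub_cancel_left]
      exact h0
    | of_succ r hr ih => exact (hG r 0 (by omega)).left.eq_zero ih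
  · rcases Nat.even_or_odd' t with ⟨c, rfl | rfl⟩
    · rw [show (2 * c + 1) / 2 = c by omega]
      simp only
      rw [show n + 1 - (n - 2 * c / 2 + c) = 1 by omega]
      rfl
    · rw [show (2 * c + 1 + 1) / 2 = c + 1 by omega]
      simp only
      rw [show n + 1 - (n - (2 * c + 1) / 2 + (c + 1)) = 0 by omega]
      rfl

end Triangle

/-! ### From a labelling back to a filling. -/

section Labelling

variable {n : ℕ} {m : ℕ → ℕ → ℕ} {G : ℕ → ℕ → ℕ → ℕ}

/-- Right of a `1`, the two ends of every vertical edge in its row have distinct labels, whereas the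
left edge of a cell containing `1` has equal ones. -/
theorem col_eq_of_labelling
    (hG : ∀ r c, r + c < n →
      LocalRule (m r c) (G r c) (G r (c + 1)) (G (r + 1) c) (G (r + 1) (c + 1)))
    {r c c' : ℕ} (hn : r + c' < n) (h1 : m r c = 1) (h2 : m r c' = 1) : c' ≤ c := by
  by_contra hlt
  have key (d : ℕ) (hd : c + 1 ≤ d) : r + d ≤ n → G (r + 1) d ≠ G r d := by
    induction d, hd using Nat.le_induction with
    | base =>
      intro _ h
      have := ((hG r c (by omega)).of_label_eq_bottom_right h).1
      omega
    | succ d hd ih =>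
      intro hdn h
      exact ih (by omega) ((hG r d (by omega)).of_label_eq_bottom_right h).2
  rcases (hG r c' hn).entry with h | h
  · omega
  · exact key c' (by omega) (by omega) h.2.2

theorem row_eq_of_labelling
    (hG : ∀ r c, r + c < n →
      LocalRule (m r c) (G r c) (G r (c + 1)) (G (r + 1) c) (G (r + 1) (c + 1)))
    {r r' c : ℕ} (hn : r' + c < n) (h1 : m r c = 1) (h2 : m r' c = 1) : r' ≤ r := by
  by_contra hlt
  have key (d : ℕ) (hd : r + 1 ≤ d) : d + c ≤ n → G d (c + 1) ≠ G d c := by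
    induction d, hd using Nat.le_induction with
    | base =>
      intro _ h
      have := ((hG r c (by omega)).of_label_eq_top_left h).1
      omega
    | succ d hd ih =>
      intro hdn h
      exact ih (by omega) ((hG d c (by omega)).of_label_eq_top_left h).2
  rcases (hG r' c hn).entry with h | h
  · omega
  · exact key r' (by omega) (by omega) h.2.1

theorem exists_filling_of_labelling
    (hG : ∀ r c, r + c < n →
      LocalRule (m r c) (G r c) (G r (c + 1)) (G (r + 1) c) (G (r + 1) (c + 1)))
    (hb : ∀ c ≤ n, G 0 c = fun _ => 0) (hl : ∀ r ≤ n, G r 0 = fun _ => 0) :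
    ∃ f : Filling01 (triangularShape n), f.RowsAtMostOne ∧ f.ColsAtMostOne ∧
      ∀ r c, r ≤ n → c ≤ n → r + c ≤ n + 1 → growthLabel f r c = G r c := by
  let f : Filling01 (triangularShape n) := fun x => if m x.1.1 x.1.2 = 1 then 1 else 0
  have hf (x : {x // x ∈ (triangularShape n).cells}) : f x = 1 ↔ m x.1.1 x.1.2 = 1 := by
    simp [f]
  refine ⟨f, ?_, ?_, fun r => ?_⟩
  · rintro ⟨⟨r, c⟩, hx⟩ ⟨⟨r', c'⟩, hy⟩ h1 h2 he
    rw [hf] at h1 h2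
    rw [mem_triangularShape] at hx hy
    obtain rfl : r = r' := he
    obtain rfl : c = c' :=
      le_antisymm (col_eq_of_labelling hG hx h2 h1) (col_eq_of_labelling hG hy h1 h2)
    rfl
  · rintro ⟨⟨r, c⟩, hx⟩ ⟨⟨r', c'⟩, hy⟩ h1 h2 he
    rw [hf] at h1 h2
    rw [mem_triangularShape] at hx hy
    obtain rfl : c = c' := he
    obtain rfl : r = r' :=
      le_antisymm (row_eq_of_labelling hG hx h2 h1) (row_eq_of_labelling hG hy h1 h2)
    rfl
  · induction r with
    | zero => exact fun c _ hc _ => (growthLabel_zero_left c).trans (hb c hc).symm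
    | succ r ihr =>
      intro c
      induction c with
      | zero => exact fun hr _ _ => (growthLabel_zero_right (r + 1)).trans (hl (r + 1) hr).symm
      | succ c ihc =>
        intro hr hc hrc
        have hlt : r + c < n := by omega
        -- Taking `1` exactly where `m` is `1` loses nothing, since the local rule allows only the
        -- entries `0` and `1`.
        have he : f.entry r c = m r c := by
          rw [Filling01.entry, dif_pos (mem_triangularShape.2 hlt)]
          rcases (hG r c hlt).entry with h | h <;> simp [f, h]
        rw [growthLabel_succ_succ, he, ihr c (by omega) (by omega) (by omega),
          ihr (c + 1) (by omega) hc (by omega), ihc hr (by omega) (by omega)]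
        exact (hG r c hlt).label.symm

theorem exists_nestingFilling {k : ℕ} {Λ : Fin (2 * n + 1) → YoungDiagram}
    (hΛ : Λ ∈ tableauSequences n k) :
    ∃ f ∈ nestingFillings n k, ∀ t, borderLabel f t = (Λ t).rowLen := by
  obtain ⟨h0, hlast, hk, hstep⟩ := hΛ
  let L : ℕ → ℕ → ℕ := fun t => if h : t < 2 * n + 1 then (Λ ⟨t, h⟩).rowLen else fun _ => 0
  have hL (t : ℕ) (h : t < 2 * n + 1) : L t = (Λ ⟨t, h⟩).rowLen := dif_pos h
  obtain ⟨m, G, hG, hb, hl, hGL⟩ := exists_labelling n L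
    ((hL 0 (by omega)).trans (funext fun i => h0 ▸ YoungDiagram.rowLen_bot i))
    ((hL (2 * n) (by omega)).trans (funext fun i =>
      (congrArg (·.rowLen i) hlast).trans (YoungDiagram.rowLen_bot i)))
    (fun i hi => by
      rw [hL (2 * i) (by omega), hL (2 * i + 1) (by omega), hL (2 * i + 2) (by omega),
        addsAtMostOne_rowLen_iff, addsAtMostOne_rowLen_iff]
      exact ⟨(hstep i hi).1, (hstep i hi).2.imp_left Eq.symm⟩)
  obtain ⟨f, hr, hc, hf⟩ := exists_filling_of_labelling hG hb hl
  have hfL (t : Fin (2 * n + 1)) : borderLabel f t = (Λ t).rowLen := by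
    rw [borderLabel, hf _ _ (by omega) (by omega) (by omega), hGL _ (by omega), hL _ t.2]
  refine ⟨f, ⟨hr, hc, (not_hasNEChain_iff_borderLabel_le f).2 fun t => ?_⟩, hfL⟩
  rw [hfL]
  exact hk t

end Labelling

/-- The fillings and the sequences of partitions are in bijection, through the bijection that reads
the labels of the growth diagram along the right/up border. -/
theorem mainTheorem4 (n k : ℕ) :
    ∃ e : nestingFillings n k ≃ tableauSequences n k,
      ∀ (f : nestingFillings n k) (t : Fin (2 * n + 1)) (i : ℕ),
        ((e f).1 t).rowLen i = borderLabel f.1 t i := by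
  choose Λ hΛ hΛf using fun f : nestingFillings n k => exists_tableauSequence f.2
  refine ⟨Equiv.ofBijective (fun f => ⟨Λ f, hΛ f⟩) ⟨fun f f' h => ?_, fun T => ?_⟩,
    fun f => hΛf f⟩
  · have h' : Λ f = Λ f' := congrArg Subtype.val h
    refine Subtype.ext (eq_of_borderLabel_eq f.2.1 f.2.2.1 f'.2.1 f'.2.2.1 fun t => ?_)
    funext i
    rw [← hΛf, ← hΛf, h']
  · obtain ⟨f, hf, hfT⟩ := exists_nestingFilling T.2
    refine ⟨⟨f, hf⟩, Subtype.ext (funext fun t => YoungDiagram.ext_rowLen fun i => ?_)⟩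
    rw [← hfT t]
    exact hΛf ⟨f, hf⟩ t i
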